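/- Recall that the crank of a partition is its largest part if $1$ is not a part, and otherwise is the number of parts larger than $\omega$ minus $\omega$, where $\omega\ge 1$ is the number of parts equal to $1$. For $n\ne 1$ let $M(m,n)$ be the number of partitions of $n$ with crank $m$; for $n=1$ put $M(-1,1)=1$, $M(0,1)=-1$, $M(1,1)=1$ and $M(m,1)=0$ for all other $m$. For $j\ge 1$ the $j$-th symmetrized crank moment is $$\mu_j(n)=\sum_{m=-n}^{n}\binom{m+\lfloor\frac{j-1}{2}\rfloor}{j}M(m,n),\qquad \binom{x}{j}=\frac{x(x-1)\cdots(x-j+1)}{j!}.$$ Write $(q)_\infty=\prod_{n\ge 1}(1-q^n)$. **Theorem.** Let $k\ge 1$ be an integer and let $q$ be a complex number with $|q|<1$. Then the product $(q)_\infty$ converges to a nonzero value, the series below converge absolutely, and $$\sum_{n=1}^{\infty}\mu_{2k}(n)\,q^n=\frac{1}{(q)_\infty}\sum_{n=1}^{\infty}(-1)^{n-1}q^{n(n-1)/2+kn}\,\frac{1+q^n}{(1-q^n)^{2k}}.$$ If moreover $q\ne 0$, then also the two-sided series below converges absolutely and $$\sum_{n=1}^{\infty}\mu_{2k}(n)\,q^n=\frac{1}{(q)_\infty}\sum_{\substack{n=-\infty\\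 n\neq 0}}^{\infty}\frac{(-1)^{n-1}q^{n(n+1)/2+kn}}{(1-q^n)^{2k}}.$$ -/

import Mathlib

/-- The crank of a partition: if `1` is not a part, it is the largest part; otherwise it is the
number of parts larger than `ω` minus `ω`, where `ω` is the number of parts equal to `1`.
(The largest part of the empty partition is read as `0`.) -/
def crank {n : ℕ} (p : n.Partition) : ℤ :=
  if 1 ∈ p.parts then
    (p.parts.countP (fun i => p.parts.count 1 < i) : ℤ) - (p.parts.count 1 : ℤ)
  else
    (p.parts.sup : ℤ)

/-- `crankCount m n` is `M(m, n)`: the number of partitions of `n` with crank `m` if `n ≠ 1`,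
while `M(-1, 1) = 1`, `M(0, 1) = -1`, `M(1, 1) = 1` and `M(m, 1) = 0` for all other `m`. -/
def crankCount (m : ℤ) (n : ℕ) : ℤ :=
  if n = 1 then
    if m = -1 then 1 else if m = 0 then -1 else if m = 1 then 1 else 0
  else
    ((Finset.univ.filter (fun p : n.Partition => crank p = m)).card : ℤ)

/-- The `k`-th symmetrized crank moment
`μ_k(n) = ∑_{m = -n}^{n} binom(m + ⌊(k - 1) / 2⌋, k) M(m, n)`. The binomial coefficient is the
generalized one, `x (x - 1) ⋯ (x - k + 1) / k!`, and integer division by `2` is the floor. -/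
noncomputable def symCrankMoment (k n : ℕ) : ℤ :=
  ∑ m ∈ Finset.Icc (-(n : ℤ)) (n : ℤ),
    Ring.choose (m + ((k : ℤ) - 1) / 2) k * crankCount m n

/-- `(q)_∞ = ∏_{n ≥ 1} (1 - q ^ n)`, for `‖q‖ < 1`. -/
noncomputable def eulerProd (q : ℂ) : ℂ :=
  ∏' n : ℕ+, (1 - q ^ (n : ℕ))

open Filter Topology Finset

/-! Sort partitions by `crankPair` `(a, b)`, for which the crank is `b - a`. Splitting a partition
into its ones, its parts in `[2, a]` and its parts larger than `a` (or splitting off the largest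
part when `a = 0`) gives the class the generating function `(1 - q) q^(ab + a + b) / ((q)_a (q)_b)`
(`hasSum_crankFiber`). This fails only at `(0, 0)` and `(0, 1)`, of crank 0 and 1, where the weight
of `μ_{2k}` vanishes.

With `m = b - a` fixed, summing over `min a b` gives `(1 - q) q^|m|` times a Durfee-type series.
Multiplied by `(q)_∞`, this becomes a partial theta series in `q^|m|` (`one_sub_mul_durfeeSum_mul`).
The identities between such series follow from a contraction argument: both sides satisfy the same
first-order recursion in `m`, so their difference is a bounded sequence with `D m = c m * D (m + 1)`
and `‖c m‖ ≤ ‖q‖`, hence zero (`eq_zero_of_eq_mul_succ`).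

Finally the sums over `m` and over the theta index `n` are exchanged (`hasSum_crankTheta`). The sum
over `m` is the two-sided binomial series `hasSum_crankWeight` at `x = q^(n + 1)`, which produces
the Lambert-type terms. The bilateral form pairs the indices `n` and `-n` (`hasSum_int_lambert`). -/

/-- The finite product `(q)_n = ∏_{i = 1}^{n} (1 - q ^ i)`. -/
def qfac {K : Type*} [Field K] (q : K) (n : ℕ) : K :=
  ∏ i ∈ Finset.range n, (1 - q ^ (i + 1))

/-! ### Durfee-type series and partial theta functions. -/

section NormedField

variable {K : Type*} [NormedField K]

lemma qfac_zero (q : K) : qfac q 0 = 1 := by simp [qfac]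

lemma qfac_succ (q : K) (n : ℕ) : qfac q (n + 1) = qfac q n * (1 - q ^ (n + 1)) := by
  simp [qfac, Finset.prod_range_succ]

lemma one_sub_ne_zero_of_norm_lt_one {x : K} (hx : ‖x‖ < 1) : 1 - x ≠ 0 := by
  intro h
  rw [← sub_eq_zero.mp h, norm_one] at hx
  exact lt_irrefl _ hx

lemma norm_pow_lt_one {q : K} (hq : ‖q‖ < 1) {n : ℕ} (hn : n ≠ 0) : ‖q ^ n‖ < 1 := by
  rw [norm_pow]
  exact pow_lt_one₀ (norm_nonneg _) hq hn

lemma one_sub_pow_ne_zero {q : K} (hq : ‖q‖ < 1) {n : ℕ} (hn : n ≠ 0) : 1 - q ^ n ≠ 0 :=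
  one_sub_ne_zero_of_norm_lt_one (norm_pow_lt_one hq hn)

lemma qfac_ne_zero {q : K} (hq : ‖q‖ < 1) (n : ℕ) : qfac q n ≠ 0 :=
  Finset.prod_ne_zero_iff.mpr fun i _ => one_sub_pow_ne_zero hq i.succ_ne_zero

lemma norm_pow_le_norm_pow {q : K} (hq : ‖q‖ < 1) {m n : ℕ} (h : m ≤ n) : ‖q ^ n‖ ≤ ‖q‖ ^ m := by
  rw [norm_pow]
  exact pow_le_pow_of_le_one (norm_nonneg _) hq.le h

lemma summable_norm_pow_succ {q : K} (hq : ‖q‖ < 1) : Summable fun i : ℕ => ‖-q ^ (i + 1)‖ := by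
  simp only [norm_neg, norm_pow]
  exact (summable_nat_add_iff 1).mpr (summable_geometric_of_lt_one (norm_nonneg _) hq)

/-- The general term of `∑ₐ q ^ (a ^ 2 + a s) / ((q)_a (q)_{a + m})`. -/
def durfeeTerm (q : K) (m s a : ℕ) : K :=
  q ^ (a * a + a * s) * ((qfac q a)⁻¹ * (qfac q (a + m))⁻¹)

lemma norm_durfeeTerm_le {q : K} (hq : ‖q‖ < 1) {C : ℝ} (hC : 0 ≤ C)
    (h : ∀ n, ‖(qfac q n)⁻¹‖ ≤ C) (m s a : ℕ) : ‖durfeeTerm q m s a‖ ≤ ‖q‖ ^ a * (C * C) := by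
  rw [durfeeTerm, norm_mul, norm_mul]
  gcongr
  · exact norm_pow_le_norm_pow hq ((Nat.le_mul_self a).trans (Nat.le_add_right _ _))
  · exact h _
  · exact h _

/-- A bounded solution of `D m = c m * D (m + 1)` with `‖c m‖ ≤ ‖q‖ < 1` vanishes. -/
lemma eq_zero_of_eq_mul_succ {q : K} (hq : ‖q‖ < 1) {D c : ℕ → K} {B : ℝ} (hB : ∀ m, ‖D m‖ ≤ B)
    (hc : ∀ m, ‖c m‖ ≤ ‖q‖) (h : ∀ m, D m = c m * D (m + 1)) (m : ℕ) : D m = 0 := by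
  have key : ∀ n m, ‖D m‖ ≤ ‖q‖ ^ n * B := by
    intro n
    induction n with
    | zero => simpa using hB
    | succ n ih =>
      intro m
      rw [h m, norm_mul, pow_succ', mul_assoc]
      exact mul_le_mul (hc m) (ih _) (norm_nonneg _) (norm_nonneg _)
  have lim : Tendsto (fun n => ‖q‖ ^ n * B) atTop (𝓝 0) := by
    simpa using (tendsto_pow_atTop_nhds_zero_of_lt_one (norm_nonneg _) hq).mul_const B
  exact norm_le_zero_iff.mp (ge_of_tendsto' lim fun n => key n m)

lemma norm_pow_succ_le {q : K} (hq : ‖q‖ < 1) (m : ℕ) : ‖q ^ (m + 1)‖ ≤ ‖q‖ := by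
  simpa using norm_pow_le_norm_pow hq (Nat.le_add_left 1 m)

lemma succ_mul_add_two_div_two (n : ℕ) : (n + 1) * (n + 1 + 1) / 2 = n * (n + 1) / 2 + (n + 1) := by
  rw [show (n + 1) * (n + 1 + 1) = n * (n + 1) + 2 * (n + 1) by ring,
    Nat.add_mul_div_left _ _ two_pos]

lemma le_mul_succ_div_two (n : ℕ) : n ≤ n * (n + 1) / 2 := by
  rw [Nat.le_div_iff_mul_le two_pos]
  rcases n with _ | n
  · simp
  · nlinarith

lemma norm_thetaTerm_le {q : K} (hq : ‖q‖ < 1) (m n : ℕ) :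
    ‖(-1) ^ n * q ^ (n * (n + 1) / 2 + n * m)‖ ≤ ‖q‖ ^ n := by
  rw [norm_mul, norm_pow, norm_neg, norm_one, one_pow, one_mul]
  exact norm_pow_le_norm_pow hq ((le_mul_succ_div_two n).trans (Nat.le_add_right _ _))

/-- The partial theta series `∑_{n ≥ 0} (-1) ^ n q ^ (n (n + 1) / 2 + n m)`. -/
noncomputable def partialTheta (q : K) (m : ℕ) : K :=
  ∑' n : ℕ, (-1) ^ n * q ^ (n * (n + 1) / 2 + n * m)

lemma norm_partialTheta_le {q : K} (hq : ‖q‖ < 1) (m : ℕ) :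
    ‖partialTheta q m‖ ≤ (1 - ‖q‖)⁻¹ :=
  tsum_of_norm_bounded (hasSum_geometric_of_lt_one (norm_nonneg _) hq) (norm_thetaTerm_le hq m)

variable [CompleteSpace K]

lemma multipliable_one_sub_pow_succ {q : K} (hq : ‖q‖ < 1) :
    Multipliable fun i : ℕ => 1 - q ^ (i + 1) := by
  simp only [sub_eq_add_neg]
  exact multipliable_one_add_of_summable (summable_norm_pow_succ hq)

lemma tprod_one_sub_pow_succ_ne_zero {q : K} (hq : ‖q‖ < 1) :
    ∏' i : ℕ, (1 - q ^ (i + 1)) ≠ 0 := by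
  simpa [sub_eq_add_neg] using tprod_one_add_ne_zero_of_summable (f := fun i : ℕ => -q ^ (i + 1))
    (fun i => by simpa [sub_eq_add_neg] using one_sub_pow_ne_zero hq i.succ_ne_zero)
    (summable_norm_pow_succ hq)

lemma tendsto_qfac {q : K} (hq : ‖q‖ < 1) :
    Tendsto (qfac q) atTop (𝓝 (∏' i : ℕ, (1 - q ^ (i + 1)))) :=
  (multipliable_one_sub_pow_succ hq).hasProd.tendsto_prod_nat

lemma tendsto_inv_qfac {q : K} (hq : ‖q‖ < 1) :
    Tendsto (fun n => (qfac q n)⁻¹) atTop (𝓝 (∏' i : ℕ, (1 - q ^ (i + 1)))⁻¹) :=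
  (tendsto_qfac hq).inv₀ (tprod_one_sub_pow_succ_ne_zero hq)

lemma exists_norm_inv_qfac_le {q : K} (hq : ‖q‖ < 1) :
    ∃ C : ℝ, 0 ≤ C ∧ ∀ n, ‖(qfac q n)⁻¹‖ ≤ C := by
  obtain ⟨C, hC⟩ := (Metric.isBounded_range_of_tendsto _ (tendsto_inv_qfac hq)).exists_norm_le
  have h : ∀ n, ‖(qfac q n)⁻¹‖ ≤ C := fun n => hC _ ⟨n, rfl⟩
  exact ⟨C, (norm_nonneg _).trans (h 0), h⟩

/-- The series `∑ₐ q ^ (a ^ 2 + a s) / ((q)_a (q)_{a + m})`. -/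
noncomputable def durfeeSum (q : K) (m s : ℕ) : K := ∑' a, durfeeTerm q m s a

lemma summable_durfeeTerm {q : K} (hq : ‖q‖ < 1) (m s : ℕ) : Summable (durfeeTerm q m s) := by
  obtain ⟨C, hC, h⟩ := exists_norm_inv_qfac_le hq
  exact Summable.of_norm_bounded
    ((summable_geometric_of_lt_one (norm_nonneg _) hq).mul_right _) (norm_durfeeTerm_le hq hC h m s)

/-- Uniformity in both `m` and `s` is what lets the contraction argument run along diagonals. -/
lemma exists_norm_durfeeSum_le {q : K} (hq : ‖q‖ < 1) :
    ∃ C : ℝ, ∀ m s, ‖durfeeSum q m s‖ ≤ C := by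
  obtain ⟨C, hC, h⟩ := exists_norm_inv_qfac_le hq
  exact ⟨_, fun m s => tsum_of_norm_bounded
    ((summable_geometric_of_lt_one (norm_nonneg _) hq).mul_right _).hasSum
    (norm_durfeeTerm_le hq hC h m s)⟩

/-- Write `q^a = 1 - (1 - q^a)`; the factor `1 - q^a` cancels against `(q)_a`, and the shift `a ↦ a
+ 1` completes the square. -/
lemma durfeeSum_succ_right {q : K} (hq : ‖q‖ < 1) (m s : ℕ) :
    durfeeSum q m (s + 1) = durfeeSum q m s - q ^ (s + 1) * durfeeSum q (m + 1) (s + 2) := by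
  have h1 := (summable_durfeeTerm hq m (s + 1)).tsum_eq_zero_add
  have h2 := (summable_durfeeTerm hq m s).tsum_eq_zero_add
  have h3 : ∀ a, durfeeTerm q m (s + 1) (a + 1) =
      durfeeTerm q m s (a + 1) - q ^ (s + 1) * durfeeTerm q (m + 1) (s + 2) a := by
    intro a
    have e1 := qfac_ne_zero hq a
    have e2 := qfac_ne_zero hq (a + 1 + m)
    have e3 := one_sub_pow_ne_zero hq a.succ_ne_zero
    simp only [durfeeTerm, show a + (m + 1) = a + 1 + m by ring, qfac_succ q a]
    field_simp
    ring
  have h4 : durfeeTerm q m (s + 1) 0 = durfeeTerm q m s 0 := by simp [durfeeTerm]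
  simp only [durfeeSum] at *
  rw [h1, h2, h4, ← tsum_mul_left, add_sub_assoc, ← Summable.tsum_sub]
  · simp only [h3]
  · exact (summable_nat_add_iff 1).mpr (summable_durfeeTerm hq m s)
  · exact (summable_durfeeTerm hq _ _).mul_left _

/-- Termwise `q^(a + m + 1) = 1 - (1 - q^(a + m + 1))`, whose last factor cancels against `(q)_{a +
m + 1}`. -/
lemma durfeeSum_succ_left {q : K} (hq : ‖q‖ < 1) (m s : ℕ) :
    q ^ (m + 1) * durfeeSum q (m + 1) (s + 1) = durfeeSum q (m + 1) s - durfeeSum q m s := by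
  simp only [durfeeSum]
  rw [← tsum_mul_left,
    ← Summable.tsum_sub (summable_durfeeTerm hq _ _) (summable_durfeeTerm hq _ _)]
  refine tsum_congr fun a => ?_
  have e1 := qfac_ne_zero hq a
  have e2 := qfac_ne_zero hq (a + m)
  have e3 := one_sub_pow_ne_zero hq (a + m).succ_ne_zero
  simp only [durfeeTerm, ← add_assoc, qfac_succ q (a + m)]
  field_simp
  ring

/-- Eliminating the mixed term from the two recursions shows that consecutive differences `D m`
along the diagonal satisfy `D m = -q^(m + 1) D (m + 1)`. -/
lemma durfeeSum_self_succ {q : K} (hq : ‖q‖ < 1) (m : ℕ) :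
    durfeeSum q (m + 1) (m + 1) = durfeeSum q m m := by
  obtain ⟨C, hC⟩ := exists_norm_durfeeSum_le hq
  refine sub_eq_zero.mp (eq_zero_of_eq_mul_succ hq (B := C + C) (c := fun m => -q ^ (m + 1))
    (D := fun m => durfeeSum q (m + 1) (m + 1) - durfeeSum q m m)
    (fun m => (norm_sub_le _ _).trans (add_le_add (hC _ _) (hC _ _)))
    (fun m => by rw [norm_neg]; exact norm_pow_succ_le hq m) (fun m => ?_) m)
  have h1 := durfeeSum_succ_right hq (m + 1) m
  have h2 := durfeeSum_succ_left hq m m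
  simp only [add_assoc, Nat.reduceAdd] at *
  linear_combination h1 - h2

/-- Durfee's rectangle identity. -/
lemma durfeeSum_self {q : K} (hq : ‖q‖ < 1) (m : ℕ) :
    durfeeSum q m m = (∏' i : ℕ, (1 - q ^ (i + 1)))⁻¹ := by
  have hconst : ∀ n, durfeeSum q n n = durfeeSum q 0 0 := fun n => by
    induction n with
    | zero => rfl
    | succ n ih => rw [durfeeSum_self_succ hq, ih]
  obtain ⟨C, hC, h⟩ := exists_norm_inv_qfac_le hq
  -- The diagonal is constant, so its value is its limit; by dominated convergence only the `a = 0`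
  -- term survives.
  have lim : Tendsto (fun n => durfeeSum q n n) atTop
      (𝓝 (∑' a : ℕ, if a = 0 then (∏' i : ℕ, (1 - q ^ (i + 1)))⁻¹ else 0)) := by
    refine tendsto_tsum_of_dominated_convergence
      ((summable_geometric_of_lt_one (norm_nonneg _) hq).mul_right (C * C)) (fun a => ?_)
      (Eventually.of_forall fun n a => norm_durfeeTerm_le hq hC h n n a)
    rcases Nat.eq_zero_or_pos a with rfl | ha
    · simpa [durfeeTerm, qfac_zero] using tendsto_inv_qfac hq
    · rw [if_neg ha.ne']
      refine squeeze_zero_norm (a := fun n => ‖q‖ ^ n * (C * C)) (fun n => ?_) ?_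
      · rw [durfeeTerm, norm_mul, norm_mul]
        gcongr
        · exact norm_pow_le_norm_pow hq (by nlinarith)
        · exact h _
        · exact h _
      · simpa using (tendsto_pow_atTop_nhds_zero_of_lt_one (norm_nonneg _) hq).mul_const (C * C)
  rw [tsum_ite_eq] at lim
  rw [hconst m]
  simp only [hconst] at lim
  exact tendsto_nhds_unique tendsto_const_nhds lim

lemma summable_thetaTerm {q : K} (hq : ‖q‖ < 1) (m : ℕ) :
    Summable fun n : ℕ => (-1) ^ n * q ^ (n * (n + 1) / 2 + n * m) :=
  Summable.of_norm_bounded (summable_geometric_of_lt_one (norm_nonneg _) hq)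
    (norm_thetaTerm_le hq m)

lemma partialTheta_eq {q : K} (hq : ‖q‖ < 1) (m : ℕ) :
    partialTheta q m = 1 - q ^ (m + 1) * partialTheta q (m + 1) := by
  rw [partialTheta, (summable_thetaTerm hq m).tsum_eq_zero_add, partialTheta, ← tsum_mul_left,
    sub_eq_add_neg, ← tsum_neg]
  congr 1
  · simp
  · refine tsum_congr fun n => ?_
    rw [succ_mul_add_two_div_two]
    ring

/-- By Durfee's identity, `durfeeSum_succ_right` at `s = m` becomes the recursion `partialTheta_eq`
after multiplication by the product. -/
lemma durfeeSum_succ_mul {q : K} (hq : ‖q‖ < 1) (m : ℕ) :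
    durfeeSum q m (m + 1) * ∏' i : ℕ, (1 - q ^ (i + 1)) = partialTheta q m := by
  obtain ⟨C, hC⟩ := exists_norm_durfeeSum_le hq
  have hP := tprod_one_sub_pow_succ_ne_zero hq
  set P := ∏' i : ℕ, (1 - q ^ (i + 1)) with hPdef
  refine sub_eq_zero.mp (eq_zero_of_eq_mul_succ hq (B := C * ‖P‖ + (1 - ‖q‖)⁻¹)
    (c := fun m => -q ^ (m + 1))
    (D := fun m => durfeeSum q m (m + 1) * P - partialTheta q m)
    (fun m => (norm_sub_le _ _).trans (add_le_add ?_ (norm_partialTheta_le hq m)))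
    (fun m => by rw [norm_neg]; exact norm_pow_succ_le hq m) (fun m => ?_) m)
  · rw [norm_mul]
    exact mul_le_mul_of_nonneg_right (hC _ _) (norm_nonneg _)
  · have h1 := durfeeSum_succ_right hq m m
    rw [durfeeSum_self hq, ← hPdef] at h1
    have h2 := partialTheta_eq hq m
    have h3 : P⁻¹ * P = 1 := inv_mul_cancel₀ hP
    linear_combination P * h1 - h2 + h3

/-- The series `∑_{n ≥ 0} (-1) ^ n q ^ (n (n + 1) / 2 + n m) (1 - q ^ (n + 1))`. -/
noncomputable def crankTheta (q : K) (m : ℕ) : K :=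
  ∑' n : ℕ, (-1) ^ n * q ^ (n * (n + 1) / 2 + n * m) * (1 - q ^ (n + 1))

lemma summable_crankThetaTerm {q : K} (hq : ‖q‖ < 1) (m : ℕ) :
    Summable fun n : ℕ => (-1) ^ n * q ^ (n * (n + 1) / 2 + n * m) * (1 - q ^ (n + 1)) := by
  refine ((summable_thetaTerm hq m).sub ((summable_thetaTerm hq (m + 1)).mul_left q)).congr
    fun n => ?_
  ring

lemma hasSum_crankThetaTerm {q : K} (hq : ‖q‖ < 1) (m : ℕ) :
    HasSum (fun n : ℕ => (-1) ^ n * q ^ (n * (n + 1) / 2 + n * m) * (1 - q ^ (n + 1)))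
      (crankTheta q m) :=
  (summable_crankThetaTerm hq m).hasSum

lemma crankTheta_eq {q : K} (hq : ‖q‖ < 1) (m : ℕ) :
    crankTheta q m = partialTheta q m - q * partialTheta q (m + 1) := by
  rw [crankTheta, partialTheta, partialTheta, ← tsum_mul_left, ← Summable.tsum_sub
    (summable_thetaTerm hq _) ((summable_thetaTerm hq _).mul_left _)]
  refine tsum_congr fun n => ?_
  ring

/-- This matches `durfeeSum_succ_right` at `s = m + 1`, whose inhomogeneous term `durfeeSum q m (m +
1)` is already known. -/
lemma crankTheta_add {q : K} (hq : ‖q‖ < 1) (m : ℕ) :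
    crankTheta q m + q ^ (m + 2) * crankTheta q (m + 1) = (1 - q) * partialTheta q m := by
  have h1 := partialTheta_eq hq m
  have h2 := partialTheta_eq hq (m + 1)
  rw [crankTheta_eq hq, crankTheta_eq hq]
  linear_combination q * h1 - q * h2

/-- The generating function of partitions of crank `m`. -/
lemma one_sub_mul_durfeeSum_mul {q : K} (hq : ‖q‖ < 1) (m : ℕ) :
    (1 - q) * durfeeSum q m (m + 2) * ∏' i : ℕ, (1 - q ^ (i + 1)) = crankTheta q m := by
  obtain ⟨C, hC⟩ := exists_norm_durfeeSum_le hq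
  have hT := durfeeSum_succ_mul hq
  set P := ∏' i : ℕ, (1 - q ^ (i + 1)) with hPdef
  refine sub_eq_zero.mp (eq_zero_of_eq_mul_succ hq
    (B := ‖1 - q‖ * C * ‖P‖ + ((1 - ‖q‖)⁻¹ + ‖q‖ * (1 - ‖q‖)⁻¹))
    (c := fun m => -q ^ (m + 2))
    (D := fun m => (1 - q) * durfeeSum q m (m + 2) * P - crankTheta q m)
    (fun m => (norm_sub_le _ _).trans (add_le_add ?_ ?_))
    (fun m => by rw [norm_neg]; exact norm_pow_succ_le hq (m + 1)) (fun m => ?_) m)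
  · rw [norm_mul, norm_mul]
    gcongr
    exact hC _ _
  · rw [crankTheta_eq hq]
    refine (norm_sub_le _ _).trans ?_
    rw [norm_mul]
    gcongr
    · exact norm_partialTheta_le hq m
    · exact norm_partialTheta_le hq _
  · have h1 := durfeeSum_succ_right hq m (m + 1)
    have h2 := crankTheta_add hq m
    have h3 := hT m
    simp only [add_assoc, Nat.reduceAdd] at *
    linear_combination (1 - q) * P * h1 - h2 + (1 - q) * h3

end NormedField

/-! ### Bijections decomposing partitions by their crank. -/

section Multisets

/-- Multisets of `b` natural numbers, all at least `k`. -/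
abbrev LargeParts (k b : ℕ) : Type := {s : Multiset ℕ // s.card = b ∧ ∀ i ∈ s, k ≤ i}

/-- Multisets of natural numbers in `[2, a]`. -/
abbrev MiddleParts (a : ℕ) : Type := {s : Multiset ℕ // ∀ i ∈ s, 2 ≤ i ∧ i ≤ a}

/-- Multisets of positive integers. -/
abbrev PosMultiset : Type := {s : Multiset ℕ // 0 ∉ s}

/-- Adjoining a new smallest part `k + d` to a multiset of parts shifted by `d`. -/
def LargeParts.consShift (k b : ℕ) (x : ℕ × LargeParts k b) : LargeParts k (b + 1) :=
  ⟨(k + x.1) ::ₘ x.2.1.map (· + x.1), by simp [x.2.2.1], by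
    intro i hi
    rcases Multiset.mem_cons.mp hi with rfl | hi
    · exact Nat.le_add_right _ _
    · obtain ⟨j, hj, rfl⟩ := Multiset.mem_map.mp hi
      exact (x.2.2.2 j hj).trans (Nat.le_add_right _ _)⟩

lemma LargeParts.le_of_mem_consShift {k b : ℕ} (x : ℕ × LargeParts k b) {i : ℕ}
    (hi : i ∈ (consShift k b x).1) : k + x.1 ≤ i := by
  rcases Multiset.mem_cons.mp hi with rfl | hi
  · exact le_rfl
  · obtain ⟨j, hj, rfl⟩ := Multiset.mem_map.mp hi
    exact Nat.add_le_add_right (x.2.2.2 j hj) _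

lemma LargeParts.consShift_bijective (k b : ℕ) : Function.Bijective (consShift k b) := by
  constructor
  · intro x y h
    have h1 : x.1 = y.1 := by
      apply le_antisymm
      · have := le_of_mem_consShift x (i := k + y.1) (by rw [h]; exact Multiset.mem_cons_self _ _)
        omega
      · have := le_of_mem_consShift y (i := k + x.1) (by rw [← h]; exact Multiset.mem_cons_self _ _)
        omega
    obtain ⟨d, t, ht⟩ := x
    obtain ⟨d', t', ht'⟩ := y
    obtain rfl : d = d' := h1
    have h2 := congrArg Subtype.val h
    simp only [consShift, Multiset.cons_inj_right] at h2
    obtain rfl := Multiset.map_injective (add_left_injective d) h2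
    rfl
  · rintro ⟨s, hs, hk⟩
    have hne : s.toFinset.Nonempty := by
      rw [Multiset.toFinset_nonempty]
      rintro rfl
      simp at hs
    obtain ⟨x, hx, hmin⟩ := Finset.exists_min_image s.toFinset id hne
    simp only [Multiset.mem_toFinset, id] at hx hmin
    obtain ⟨d, rfl⟩ := Nat.exists_eq_add_of_le (hk x hx)
    obtain ⟨t, rfl⟩ := Multiset.exists_cons_of_mem hx
    have ht : (t.map (· - d)).map (· + d) = t := by
      rw [Multiset.map_map]
      conv_rhs => rw [← Multiset.map_id t]
      refine Multiset.map_congr rfl fun i hi => ?_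
      have := hmin i (Multiset.mem_cons_of_mem hi)
      simp only [Function.comp, id]
      omega
    refine ⟨(d, ⟨t.map (· - d), by simpa using hs, fun i hi => ?_⟩), Subtype.ext ?_⟩
    · obtain ⟨j, hj, rfl⟩ := Multiset.mem_map.mp hi
      have := hmin j (Multiset.mem_cons_of_mem hj)
      omega
    · simp only [consShift]
      rw [ht]

/-- All `b + 1` parts contain the shift, hence the geometric series in `q^(b + 1)` in
`hasSum_largeParts`. -/
lemma LargeParts.sum_consShift {k b : ℕ} (x : ℕ × LargeParts k b) :
    (consShift k b x).1.sum = k + (b + 1) * x.1 + x.2.1.sum := by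
  simp only [consShift, Multiset.sum_cons, Multiset.sum_map_add, Multiset.map_id',
    Multiset.map_const', Multiset.sum_replicate, x.2.2.1, smul_eq_mul]
  ring

/-- A multiset with parts in `[2, a + 1]` is given by the multiplicity of `a + 1` and the rest. -/
def MiddleParts.succEquiv {a : ℕ} (ha : 1 ≤ a) : ℕ × MiddleParts a ≃ MiddleParts (a + 1) where
  toFun x := ⟨Multiset.replicate x.1 (a + 1) + x.2.1, fun i hi => by
    rcases Multiset.mem_add.mp hi with hi | hi
    · obtain rfl := Multiset.eq_of_mem_replicate hi
      omega
    · have := x.2.2 i hi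
      omega⟩
  invFun s := (s.1.count (a + 1), ⟨s.1.filter (· ≤ a), fun i hi => by
    have h := Multiset.mem_filter.mp hi
    exact ⟨(s.2 i h.1).1, h.2⟩⟩)
  left_inv := by
    rintro ⟨c, t, ht⟩
    have h0 : a + 1 ∉ t := fun h => by have := (ht _ h).2; omega
    refine Prod.ext ?_ (Subtype.ext ?_)
    · simp [Multiset.count_eq_zero.mpr h0]
    · simp only [Multiset.filter_add]
      rw [Multiset.filter_eq_nil.mpr, Multiset.filter_eq_self.mpr fun i hi => (ht i hi).2, zero_add]
      intro i hi
      obtain rfl := Multiset.eq_of_mem_replicate hi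
      omega
  right_inv := by
    rintro ⟨s, hs⟩
    refine Subtype.ext (Multiset.ext.mpr fun i => ?_)
    by_cases hi : i ∈ s
    · have h := hs i hi
      rcases Nat.lt_or_ge a i with h1 | h1
      · obtain rfl : i = a + 1 := by omega
        simp
      · simp [Multiset.count_replicate, h1, show a + 1 ≠ i by omega]
    · have h1 : i ∉ s.filter (· ≤ a) := fun h => hi (Multiset.mem_of_mem_filter h)
      rcases eq_or_ne i (a + 1) with rfl | h2
      · simp
      · simp [Multiset.count_replicate, h2.symm, hi]

/-- A pair `(a, b)` attached to a multiset, whose difference `b - a` is the crank: `a` is the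
multiplicity of `1`, and `b` is the number of parts larger than `a` if `a > 0`, and the largest
part if `a = 0`. -/
def crankPair (s : Multiset ℕ) : ℕ × ℕ :=
  (s.count 1, if 1 ∈ s then s.countP (fun i => s.count 1 < i) else s.sup)

lemma crank_eq_crankPair {n : ℕ} (p : n.Partition) :
    crank p = (crankPair p.parts).2 - (crankPair p.parts).1 := by
  unfold crank crankPair
  split_ifs with h
  · rfl
  · simp [Multiset.count_eq_zero.mpr h]

/-- The positive multisets with given `crankPair`. -/
abbrev CrankFiber (x : ℕ × ℕ) : Type := {s : PosMultiset // crankPair s.1 = x}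

lemma sup_eq_of_mem_of_le {s : Multiset ℕ} {b : ℕ} (hb : b ∈ s) (h : ∀ i ∈ s, i ≤ b) :
    s.sup = b :=
  le_antisymm (Multiset.sup_le.mpr h) (Multiset.le_sup hb)

lemma sup_mem_of_ne_zero {s : Multiset ℕ} (hs : s.sup ≠ 0) : s.sup ∈ s := by
  induction s using Multiset.induction with
  | empty => simp at hs
  | cons a s ih =>
    rw [Multiset.sup_cons] at hs ⊢
    rcases le_total s.sup a with h | h
    · rw [sup_eq_left.mpr h]
      exact Multiset.mem_cons_self _ _
    · rw [sup_eq_right.mpr h] at hs ⊢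
      exact Multiset.mem_cons_of_mem (ih hs)

/-- Multisets without `1` and with largest part `b ≥ 2`. -/
def crankFiberZeroEquiv {b : ℕ} (hb : 2 ≤ b) : MiddleParts b ≃ CrankFiber (0, b) where
  toFun t := ⟨⟨b ::ₘ t.1, fun h => by
      rcases Multiset.mem_cons.mp h with h | h
      · omega
      · exact absurd (t.2 0 h).1 (by omega)⟩, by
    have h1 : 1 ∉ b ::ₘ t.1 := fun h => by
      rcases Multiset.mem_cons.mp h with h | h
      · omega
      · exact absurd (t.2 1 h).1 (by omega)
    simp only [crankPair, if_neg h1, Multiset.count_eq_zero.mpr h1]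
    rw [sup_eq_of_mem_of_le (Multiset.mem_cons_self b _)]
    intro i hi
    rcases Multiset.mem_cons.mp hi with rfl | h
    · exact le_rfl
    · exact (t.2 i h).2⟩
  invFun s := ⟨s.1.1.erase b, fun i hi => by
    have h0 := s.1.2
    have h := s.2
    simp only [crankPair, Prod.mk.injEq, Multiset.count_eq_zero] at h
    rw [if_neg h.1] at h
    have hi' := Multiset.mem_of_mem_erase hi
    refine ⟨?_, h.2 ▸ Multiset.le_sup hi'⟩
    by_contra hlt
    have : i = 0 ∨ i = 1 := by omega
    rcases this with rfl | rfl
    · exact h0 hi'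
    · exact h.1 hi'⟩
  left_inv t := Subtype.ext (by simp)
  right_inv s := by
    refine Subtype.ext (Subtype.ext (Multiset.cons_erase ?_))
    have h := s.2
    simp only [crankPair, Prod.mk.injEq, Multiset.count_eq_zero] at h
    rw [if_neg h.1] at h
    have := sup_mem_of_ne_zero (s := s.1.1) (by omega)
    rwa [h.2] at this

/-- Multisets with `a ≥ 1` parts `1` and `b` parts larger than `a`. -/
def crankFiberPosEquiv {a : ℕ} (ha : 1 ≤ a) (b : ℕ) :
    MiddleParts a × LargeParts (a + 1) b ≃ CrankFiber (a, b) where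
  toFun x := ⟨⟨Multiset.replicate a 1 + x.1.1 + x.2.1, fun h => by
      simp only [Multiset.mem_add] at h
      rcases h with (h | h) | h
      · exact absurd (Multiset.eq_of_mem_replicate h) (by omega)
      · exact absurd (x.1.2 0 h).1 (by omega)
      · exact absurd (x.2.2.2 0 h) (by omega)⟩, by
    have h1 : (1 : ℕ) ∉ x.1.1 := fun h => absurd (x.1.2 1 h).1 (by omega)
    have h2 : (1 : ℕ) ∉ x.2.1 := fun h => absurd (x.2.2.2 1 h) (by omega)
    have hc : (Multiset.replicate a 1 + x.1.1 + x.2.1).count 1 = a := by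
      simp [Multiset.count_eq_zero.mpr h1, Multiset.count_eq_zero.mpr h2]
    have h3 : 1 ∈ Multiset.replicate a 1 + x.1.1 + x.2.1 := by
      rw [← Multiset.count_pos, hc]
      exact ha
    simp only [crankPair, if_pos h3, hc, Multiset.countP_add]
    rw [Multiset.countP_eq_zero.mpr, Multiset.countP_eq_zero.mpr, Multiset.countP_eq_card.mpr,
      x.2.2.1, zero_add, zero_add]
    · exact fun i hi => x.2.2.2 i hi
    · exact fun i hi => not_lt.mpr (x.1.2 i hi).2
    · intro i hi
      obtain rfl := Multiset.eq_of_mem_replicate hi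
      omega⟩
  invFun s := (⟨s.1.1.filter (fun i => 2 ≤ i ∧ i ≤ a), fun _ hi => (Multiset.mem_filter.mp hi).2⟩,
    ⟨s.1.1.filter (fun i => a < i), by
      have h := s.2
      simp only [crankPair, Prod.mk.injEq] at h
      have h3 : 1 ∈ s.1.1 := by
        rw [← Multiset.count_pos]
        omega
      rw [if_pos h3, h.1] at h
      exact (Multiset.countP_eq_card_filter _ _).symm.trans h.2, fun _ hi => (Multiset.mem_filter.mp hi).2⟩)
  left_inv := by
    rintro ⟨⟨m, hm⟩, ⟨l, hl, hl'⟩⟩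
    refine Prod.ext (Subtype.ext ?_) (Subtype.ext ?_)
    · simp only [Multiset.filter_add]
      rw [Multiset.filter_eq_nil.mpr, Multiset.filter_eq_self.mpr hm, Multiset.filter_eq_nil.mpr,
        zero_add, add_zero]
      · intro i hi
        have := hl' i hi
        omega
      · intro i hi
        obtain rfl := Multiset.eq_of_mem_replicate hi
        omega
    · simp only [Multiset.filter_add]
      rw [Multiset.filter_eq_nil.mpr, Multiset.filter_eq_nil.mpr, Multiset.filter_eq_self.mpr,
        zero_add, zero_add]
      · exact fun i hi => hl' i hi
      · exact fun i hi => not_lt.mpr (hm i hi).2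
      · intro i hi
        obtain rfl := Multiset.eq_of_mem_replicate hi
        omega
  right_inv := by
    rintro ⟨⟨s, hs⟩, h⟩
    simp only [crankPair, Prod.mk.injEq] at h
    refine Subtype.ext (Subtype.ext (Multiset.ext.mpr fun i => ?_))
    simp only [Multiset.count_add, Multiset.count_replicate, Multiset.count_filter]
    rcases Nat.lt_or_ge a i with h1 | h1
    · rw [if_neg (by omega), if_neg (by omega), if_pos h1, zero_add, zero_add]
    · rcases Nat.lt_or_ge 1 i with h2 | h2
      · rw [if_neg (by omega), if_pos (by omega), if_neg (by omega), zero_add, add_zero]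
      · obtain rfl | rfl : i = 0 ∨ i = 1 := by omega
        · simp [Multiset.count_eq_zero.mpr hs]
        · simp [h.1, show ¬ a < 1 by omega]

/-- Partitions of all natural numbers are the multisets of positive integers. -/
def sigmaPartitionEquiv : (Σ n : ℕ, n.Partition) ≃ PosMultiset where
  toFun p := ⟨p.2.parts, fun h => lt_irrefl _ (p.2.parts_pos h)⟩
  invFun s := ⟨s.1.sum, ⟨s.1, fun h => Nat.pos_of_ne_zero fun h0 => s.2 (h0 ▸ h), rfl⟩⟩
  left_inv := by
    rintro ⟨_, ⟨s, h, rfl⟩⟩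
    rfl
  right_inv _ := rfl

end Multisets

/-! ### Generating functions of the crank classes. -/

section HasSum

variable {K : Type*} [RCLike K]

lemma hasSum_mul_prod {α β : Type*} {f : α → K} {g : β → K} {s t : K} (hf : HasSum f s)
    (hg : HasSum g t) : HasSum (fun x : α × β => f x.1 * g x.2) (s * t) :=
  hf.mul hg (summable_mul_of_summable_norm hf.summable.norm hg.summable.norm)

lemma hasSum_geometric_pow_succ {q : K} (hq : ‖q‖ < 1) (n : ℕ) :
    HasSum (fun d : ℕ => (q ^ (n + 1)) ^ d) (1 - q ^ (n + 1))⁻¹ :=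
  hasSum_geometric_of_norm_lt_one (norm_pow_lt_one hq n.succ_ne_zero)

lemma hasSum_largeParts {q : K} (hq : ‖q‖ < 1) (k b : ℕ) :
    HasSum (fun s : LargeParts k b => q ^ s.1.sum) (q ^ (k * b) * (qfac q b)⁻¹) := by
  induction b with
  | zero =>
    have : Unique (LargeParts k 0) :=
      { default := ⟨0, by simp, by simp⟩
        uniq := fun s => Subtype.ext (Multiset.card_eq_zero.mp s.2.1) }
    convert! hasSum_unique (fun s : LargeParts k 0 => q ^ s.1.sum) using 1
    rw [Multiset.card_eq_zero.mp (default : LargeParts k 0).2.1]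
    simp [qfac_zero]
  | succ b ih =>
    rw [← (Equiv.ofBijective _ (LargeParts.consShift_bijective k b)).hasSum_iff]
    have h := (hasSum_mul_prod (hasSum_geometric_pow_succ hq b) ih).mul_left (q ^ k)
    convert! h using 1
    · funext x
      simp only [Function.comp, Equiv.ofBijective_apply, LargeParts.sum_consShift]
      ring
    · rw [qfac_succ, mul_inv]
      ring

/-- The factor `1 - q` removes the part 1 from the generating function of parts at most `a`. -/
lemma hasSum_middleParts {q : K} (hq : ‖q‖ < 1) {a : ℕ} (ha : 1 ≤ a) :
    HasSum (fun s : MiddleParts a => q ^ s.1.sum) ((1 - q) * (qfac q a)⁻¹) := by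
  induction a, ha using Nat.le_induction with
  | base =>
    have : Unique (MiddleParts 1) :=
      { default := ⟨0, by simp⟩
        uniq := fun s => Subtype.ext (Multiset.eq_zero_of_forall_notMem fun i hi => by
          have := s.2 i hi
          omega) }
    convert! hasSum_unique (fun s : MiddleParts 1 => q ^ s.1.sum) using 1
    have h : (default : MiddleParts 1).1 = 0 :=
      Multiset.eq_zero_of_forall_notMem fun i hi => by
        have := (default : MiddleParts 1).2 i hi
        omega
    rw [h]
    have := one_sub_ne_zero_of_norm_lt_one hq
    simp [qfac, this]
  | succ a ha ih =>
    rw [← (MiddleParts.succEquiv ha).hasSum_iff]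
    have h := hasSum_mul_prod (hasSum_geometric_pow_succ hq a) ih
    convert! h using 1
    · funext x
      simp only [Function.comp, MiddleParts.succEquiv, Equiv.coe_fn_mk, Multiset.sum_add,
        Multiset.sum_replicate, smul_eq_mul]
      ring
    · rw [qfac_succ, mul_inv]
      ring

/-- The generating function of the multisets with `crankPair` equal to `x`. -/
def crankKernel (q : K) (x : ℕ × ℕ) : K :=
  (1 - q) * q ^ (x.1 * x.2 + x.1 + x.2) * ((qfac q x.1)⁻¹ * (qfac q x.2)⁻¹)

lemma hasSum_crankFiber {q : K} (hq : ‖q‖ < 1) {x : ℕ × ℕ} (hx : 1 ≤ x.1 ∨ 2 ≤ x.2) :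
    HasSum (fun s : CrankFiber x => q ^ s.1.1.sum) (crankKernel q x) := by
  obtain ⟨a, b⟩ := x
  rcases Nat.eq_zero_or_pos a with rfl | ha
  · have hb : 2 ≤ b := by simpa using hx
    rw [← (crankFiberZeroEquiv hb).hasSum_iff]
    have h := (hasSum_middleParts hq (show 1 ≤ b by omega)).mul_left (q ^ b)
    convert! h using 1
    · funext t
      simp [crankFiberZeroEquiv, pow_add]
    · simp only [crankKernel, qfac_zero, zero_mul, zero_add, inv_one]
      ring
  · rw [← (crankFiberPosEquiv ha b).hasSum_iff]
    have h := (hasSum_mul_prod (hasSum_middleParts hq ha)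
      (hasSum_largeParts hq (a + 1) b)).mul_left (q ^ a)
    convert! h using 1
    · funext t
      simp [crankFiberPosEquiv, pow_add, mul_assoc]
    · simp only [crankKernel]
      ring

/-- Summing `w (crank p) q ^ |p|` over all partitions, for a weight with `w 0 = w 1 = 0`. -/
lemma hasSum_partition {q : ℂ} (hq : ‖q‖ < 1) {w : ℤ → ℂ} (h0 : w 0 = 0) (h1 : w 1 = 0)
    (hs : Summable fun x : ℕ × ℕ => ‖w (x.2 - x.1)‖ * crankKernel ‖q‖ x) :
    HasSum (fun n : ℕ => (∑ p : n.Partition, w (crank p)) * q ^ n)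
      (∑' x : ℕ × ℕ, w (x.2 - x.1) * crankKernel q x) := by
  -- Stated over a general field, since it is used over `ℝ` at `‖q‖` for absolute convergence and
  -- over `ℂ` at `q` for the value.
  have hfib : ∀ {K : Type} [RCLike K] {q : K}, ‖q‖ < 1 → ∀ (w : ℤ → K), w 0 = 0 → w 1 = 0 →
      ∀ x : ℕ × ℕ, HasSum (fun s : CrankFiber x =>
        w ((crankPair s.1.1).2 - (crankPair s.1.1).1) * q ^ s.1.1.sum)
        (w (x.2 - x.1) * crankKernel q x) := by
    intro K _ q hq w h0 h1 x
    have e : (fun s : CrankFiber x =>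
        w ((crankPair s.1.1).2 - (crankPair s.1.1).1) * q ^ s.1.1.sum) =
        fun s : CrankFiber x => w (x.2 - x.1) * q ^ s.1.1.sum := by
      funext s
      rw [s.2]
    rw [e]
    by_cases hx : 1 ≤ x.1 ∨ 2 ≤ x.2
    · exact (hasSum_crankFiber hq hx).mul_left _
    -- Only `(0, 0)` and `(0, 1)` remain, where the kernel is not the generating function of the
    -- class, but the weight is zero.
    · have hw : w (x.2 - x.1) = 0 := by
        have e1 : x.1 = 0 := by omega
        have : x.2 = 0 ∨ x.2 = 1 := by omega
        rcases this with e2 | e2 <;> simp [e1, e2, h0, h1]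
      simp [hw]
  let F : PosMultiset → ℂ := fun s => w ((crankPair s.1).2 - (crankPair s.1).1) * q ^ s.1.sum
  let e := Equiv.sigmaFiberEquiv (fun s : PosMultiset => crankPair s.1)
  have hr : ‖‖q‖‖ < 1 := by rwa [norm_norm]
  have hnorm := hfib hr (fun m => ‖w m‖) (by simp [h0]) (by simp [h1])
  have hsum : Summable (F ∘ e) := by
    refine Summable.of_norm ?_
    rw [summable_sigma_of_nonneg fun _ => norm_nonneg _]
    have hF : ∀ (x : ℕ × ℕ), (fun y => ‖(F ∘ e) ⟨x, y⟩‖) = fun s : CrankFiber x =>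
        ‖w ((crankPair s.1.1).2 - (crankPair s.1.1).1)‖ * ‖q‖ ^ s.1.1.sum := by
      intro x
      funext s
      simp [F, e, Equiv.sigmaFiberEquiv]
    refine ⟨fun x => ?_, ?_⟩
    · rw [hF x]
      exact (hnorm x).summable
    · refine hs.congr fun x => ?_
      rw [hF x]
      exact (hnorm x).tsum_eq.symm
  have h2 : HasSum (fun x : ℕ × ℕ => w (x.2 - x.1) * crankKernel q x) (∑' z, (F ∘ e) z) :=
    hsum.hasSum.sigma fun x => hfib hq w h0 h1 x
  rw [h2.tsum_eq]
  have h3 : HasSum (F ∘ sigmaPartitionEquiv) (∑' z, (F ∘ e) z) := by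
    rw [sigmaPartitionEquiv.hasSum_iff, ← e.hasSum_iff]
    exact hsum.hasSum
  refine h3.sigma fun n => ?_
  rw [Finset.sum_mul]
  convert! hasSum_fintype (fun p : n.Partition => w (crank p) * q ^ n) using 1
  funext p
  simp [F, sigmaPartitionEquiv, crank_eq_crankPair, p.parts_sum]

end HasSum

/-! ### The binomial weights and their two-sided generating function. -/

section CrankWeight

/-- The weight `binom(m + k - 1, 2 k)` of crank `m` in the symmetrized moment of order `2 k`. -/
def crankWeight (k : ℕ) (m : ℤ) : ℤ := Ring.choose (m + ((k : ℤ) - 1)) (2 * k)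

lemma crankWeight_natCast {k : ℕ} (hk : 1 ≤ k) (n : ℕ) :
    crankWeight k n = (n + (k - 1)).choose (2 * k) := by
  rw [crankWeight, ← Ring.choose_natCast]
  push_cast [hk]
  rfl

/-- Upper negation of the binomial; the sign is trivial because the lower index is even. -/
lemma crankWeight_neg_natCast (k n : ℕ) : crankWeight k (-n) = (n + k).choose (2 * k) := by
  rw [crankWeight, show -(n : ℤ) + ((k : ℤ) - 1) = -((n : ℤ) + 1 - k) by ring, Ring.choose_neg,
    ← Ring.choose_natCast, Int.negOnePow_even _ (by simp), one_smul]
  congr 1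
  push_cast
  ring

lemma crankWeight_zero {k : ℕ} (hk : 1 ≤ k) : crankWeight k 0 = 0 := by
  have := crankWeight_natCast hk 0
  rw [Nat.choose_eq_zero_of_lt (by omega)] at this
  simpa using this

lemma crankWeight_one {k : ℕ} (hk : 1 ≤ k) : crankWeight k 1 = 0 := by
  have := crankWeight_natCast hk 1
  rw [Nat.choose_eq_zero_of_lt (by omega)] at this
  simpa using this

lemma abs_crankWeight_le {k : ℕ} (hk : 1 ≤ k) (m : ℤ) :
    |crankWeight k m| ≤ ((m.natAbs + k : ℕ) : ℤ) ^ (2 * k) := by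
  rcases Int.natAbs_eq m with h | h
  · rw [h, crankWeight_natCast hk, Int.natAbs_natCast, Nat.abs_cast]
    norm_cast
    exact (Nat.choose_le_pow _ _).trans (Nat.pow_le_pow_left (by omega) _)
  · rw [h, crankWeight_neg_natCast, Int.natAbs_neg, Int.natAbs_natCast, Nat.abs_cast]
    norm_cast
    exact Nat.choose_le_pow _ _

lemma norm_crankWeight_le {k : ℕ} (hk : 1 ≤ k) (m : ℤ) :
    ‖(crankWeight k m : ℂ)‖ ≤ ((m.natAbs : ℝ) + k) ^ (2 * k) := by
  have h := abs_crankWeight_le hk m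
  rw [Complex.norm_intCast, ← Int.cast_abs]
  generalize m.natAbs = n at h ⊢
  have h' := (Int.cast_le (R := ℝ)).mpr h
  push_cast at h' ⊢
  exact h'

lemma hasSum_of_hasSum_nat_add {f : ℕ → ℂ} {a : ℂ} (N : ℕ) (h0 : ∀ n < N, f n = 0)
    (h : HasSum (fun n => f (n + N)) a) : HasSum f a := by
  rw [← hasSum_nat_add_iff' N, Finset.sum_eq_zero fun n hn => h0 n (Finset.mem_range.mp hn),
    sub_zero]
  exact h

lemma hasSum_crankWeight_natCast {k : ℕ} (hk : 1 ≤ k) {x : ℂ} (hx : ‖x‖ < 1) :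
    HasSum (fun n : ℕ => ((n + (k - 1)).choose (2 * k) : ℂ) * x ^ n)
      (x ^ (k + 1) * (1 / (1 - x) ^ (2 * k + 1))) := by
  refine hasSum_of_hasSum_nat_add (k + 1) (fun n hn => ?_) ?_
  · rw [Nat.choose_eq_zero_of_lt (by omega), Nat.cast_zero, zero_mul]
  · refine ((hasSum_choose_mul_geometric_of_norm_lt_one (2 * k) hx).mul_left
      (x ^ (k + 1))).congr_fun fun n => ?_
    rw [show n + (k + 1) + (k - 1) = n + 2 * k by omega]
    ring

lemma hasSum_crankWeight_neg {k : ℕ} (hk : 1 ≤ k) {x : ℂ} (hx : ‖x‖ < 1) :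
    HasSum (fun n : ℕ => ((n + 1 + k).choose (2 * k) : ℂ) * x ^ (n + 1))
      (x ^ k * (1 / (1 - x) ^ (2 * k + 1))) := by
  refine hasSum_of_hasSum_nat_add (k - 1) (fun n hn => ?_) ?_
  · rw [Nat.choose_eq_zero_of_lt (by omega), Nat.cast_zero, zero_mul]
  · refine ((hasSum_choose_mul_geometric_of_norm_lt_one (2 * k) hx).mul_left
      (x ^ k)).congr_fun fun n => ?_
    rw [show n + (k - 1) + 1 + k = n + 2 * k by omega, show n + (k - 1) + 1 = n + k by omega]
    ring

/-- The two-sided generating function of the weights. -/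
lemma hasSum_crankWeight {k : ℕ} (hk : 1 ≤ k) {x : ℂ} (hx : ‖x‖ < 1) :
    HasSum (fun m : ℤ => (crankWeight k m : ℂ) * x ^ m.natAbs)
      (x ^ k * (1 + x) / (1 - x) ^ (2 * k + 1)) := by
  have h1 : HasSum (fun n : ℕ => (crankWeight k n : ℂ) * x ^ (n : ℤ).natAbs)
      (x ^ (k + 1) * (1 / (1 - x) ^ (2 * k + 1))) :=
    (hasSum_crankWeight_natCast hk hx).congr_fun fun n => by
      rw [crankWeight_natCast hk, Int.natAbs_natCast, Int.cast_natCast]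
  have h2 : HasSum (fun n : ℕ => (crankWeight k (-((n : ℤ) + 1)) : ℂ) *
      x ^ (-((n : ℤ) + 1)).natAbs) (x ^ k * (1 / (1 - x) ^ (2 * k + 1))) :=
    (hasSum_crankWeight_neg hk hx).congr_fun fun n => by
      have := crankWeight_neg_natCast k (n + 1)
      rw [Nat.cast_succ] at this
      rw [this, Int.natAbs_neg, show ((n : ℤ) + 1).natAbs = n + 1 by omega, Int.cast_natCast]
  have h3 := HasSum.of_nat_of_neg_add_one
    (f := fun m : ℤ => (crankWeight k m : ℂ) * x ^ m.natAbs) h1 h2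
  rwa [show x ^ (k + 1) * (1 / (1 - x) ^ (2 * k + 1)) + x ^ k * (1 / (1 - x) ^ (2 * k + 1)) =
    x ^ k * (1 + x) / (1 - x) ^ (2 * k + 1) by ring] at h3

end CrankWeight

/-! ### Moments as weighted sums over partitions. -/

section CrankMoment

lemma crank_mem_Icc {n : ℕ} (p : n.Partition) : crank p ∈ Finset.Icc (-(n : ℤ)) n := by
  have hcard : p.parts.card ≤ n := by
    have := Multiset.card_nsmul_le_sum (s := p.parts) (a := 1) fun i hi => p.parts_pos hi
    simpa [p.parts_sum] using this
  have h1 := (Multiset.count_le_card 1 p.parts).trans hcard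
  have h2 : ∀ a, p.parts.countP (fun i => a < i) ≤ n :=
    fun a => (Multiset.countP_le_card _ _).trans hcard
  have h3 : p.parts.sup ≤ n := Multiset.sup_le.mpr fun i hi => Nat.Partition.le_of_mem_parts hi
  have h4 := h2 (p.parts.count 1)
  rw [Finset.mem_Icc]
  unfold crank
  split_ifs <;> omega

/-- The exceptional convention at `n = 1` does no harm: the one partition has crank `-1`, and the
extra values sit at cranks 0 and 1, of weight zero. -/
lemma symCrankMoment_two_mul {k : ℕ} (hk : 1 ≤ k) (n : ℕ) :
    symCrankMoment (2 * k) n = ∑ p : n.Partition, crankWeight k (crank p) := by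
  have hw : ∀ m : ℤ, Ring.choose (m + (((2 * k : ℕ) : ℤ) - 1) / 2) (2 * k) = crankWeight k m := by
    intro m
    rw [crankWeight]
    congr 2
    omega
  simp only [symCrankMoment, hw]
  by_cases hn : n = 1
  · subst hn
    have hI : Finset.Icc (-((1 : ℕ) : ℤ)) ((1 : ℕ) : ℤ) = {-1, 0, 1} := by decide
    rw [hI]
    simp [crankCount, crankWeight_zero hk, crankWeight_one hk, crank,
      show Multiset.countP (fun x => 1 < x) ({1} : Multiset ℕ) = 0 by decide]
  · rw [← Finset.sum_fiberwise_of_maps_to (s := Finset.univ)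
      (fun p _ => crank_mem_Icc (n := n) p)]
    refine Finset.sum_congr rfl fun m _ => ?_
    rw [crankCount, if_neg hn, Finset.sum_congr rfl fun p hp => by rw [(Finset.mem_filter.mp hp).2],
      Finset.sum_const, nsmul_eq_mul, mul_comm]

end CrankMoment

/-! ### Absolute convergence, exchange of sums, and the bilateral form. -/

section Summation

lemma one_sub_norm_le {x : ℂ} {r : ℝ} (h : ‖x‖ ≤ r) : 1 - r ≤ ‖1 - x‖ := by
  have := norm_sub_norm_le (1 : ℂ) x
  rw [norm_one] at this
  linarith

/-- Polynomial growth of the weight against geometric decay of the kernel; since `k ≥ 1`, the bound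
`a + b + k ≤ k (a + 1)(b + 1)` separates the variables. -/
lemma summable_crankKernel {k : ℕ} (hk : 1 ≤ k) {q : ℂ} (hq : ‖q‖ < 1) {K : Type*} [RCLike K]
    {z : K} (hz : ‖z‖ = ‖q‖) :
    Summable fun x : ℕ × ℕ => ‖(crankWeight k ((x.2 : ℤ) - x.1) : ℂ)‖ * ‖crankKernel z x‖ := by
  obtain ⟨C, hC, h⟩ := exists_norm_inv_qfac_le (q := z) (hz ▸ hq)
  have hpow : Summable fun n : ℕ => ((n : ℝ) + 1) ^ (2 * k) * ‖q‖ ^ n := by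
    rcases eq_or_ne ‖q‖ 0 with h0 | h0
    · refine summable_of_ne_finset_zero (s := {0}) fun n hn => ?_
      rw [h0, zero_pow (by simpa using hn), mul_zero]
    · have := (summable_nat_add_iff 1).mpr (summable_pow_mul_geometric_of_norm_lt_one (2 * k)
        (r := ‖q‖) (by rwa [norm_norm]))
      refine (this.mul_right ‖q‖⁻¹).congr fun n => ?_
      push_cast
      rw [pow_succ]
      field_simp
  have hnn : ∀ n : ℕ, 0 ≤ ((n : ℝ) + 1) ^ (2 * k) * ‖q‖ ^ n := fun n => by positivity
  refine Summable.of_nonneg_of_le (fun x => by positivity) (fun x => ?_)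
    ((hpow.mul_of_nonneg hpow hnn hnn).mul_left ((k : ℝ) ^ (2 * k) * (‖1 - z‖ * (C * C))))
  have hw : ‖(crankWeight k ((x.2 : ℤ) - x.1) : ℂ)‖ ≤
      ((k : ℝ) * ((x.1 + 1) * (x.2 + 1))) ^ (2 * k) := by
    refine (norm_crankWeight_le hk _).trans (pow_le_pow_left₀ (by positivity) ?_ _)
    have h1 : ((x.2 : ℤ) - x.1).natAbs + k ≤ x.1 + x.2 + k := by omega
    have h2 : x.1 + x.2 + k ≤ k * ((x.1 + 1) * (x.2 + 1)) := by nlinarith [Nat.zero_le (x.1 * x.2)]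
    exact_mod_cast h1.trans h2
  have hK : ‖crankKernel z x‖ ≤ ‖1 - z‖ * (‖q‖ ^ x.1 * ‖q‖ ^ x.2) * (C * C) := by
    rw [crankKernel, norm_mul, norm_mul, norm_mul, ← pow_add, ← hz]
    gcongr
    · exact norm_pow_le_norm_pow (hz ▸ hq) (by rw [add_assoc]; exact Nat.le_add_left _ _)
    · exact h _
    · exact h _
  refine (mul_le_mul hw hK (norm_nonneg _) (by positivity)).trans (le_of_eq ?_)
  rw [mul_pow, mul_pow]
  ring

/-- Pairs of natural numbers, described by their difference and their minimum. -/
def diffMinEquiv : ℤ × ℕ ≃ ℕ × ℕ where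
  toFun x := (x.2 + (-x.1).toNat, x.2 + x.1.toNat)
  invFun y := ((y.2 : ℤ) - y.1, min y.1 y.2)
  left_inv x := by
    refine Prod.ext ?_ ?_
    · simp only
      omega
    · simp only
      omega
  right_inv y := by
    refine Prod.ext ?_ ?_
    · simp only
      omega
    · simp only
      omega

/-- The kernel is symmetric, and with entries `c` and `c + |m|` its exponent is `|m| + c^2 + c (|m|
+ 2)`. -/
lemma crankKernel_diffMinEquiv (q : ℂ) (m : ℤ) (c : ℕ) :
    crankKernel q (diffMinEquiv (m, c)) =
      (1 - q) * q ^ m.natAbs * durfeeTerm q m.natAbs (m.natAbs + 2) c := by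
  rcases Int.natAbs_eq m with h | h
  · generalize m.natAbs = n at h
    subst h
    simp only [diffMinEquiv, crankKernel, durfeeTerm, Equiv.coe_fn_mk, Int.toNat_neg_natCast,
      Int.toNat_natCast, add_zero]
    ring
  · generalize m.natAbs = n at h
    subst h
    simp only [diffMinEquiv, crankKernel, durfeeTerm, Equiv.coe_fn_mk, Int.toNat_neg_natCast,
      Int.toNat_natCast, add_zero, neg_neg]
    ring

lemma hasSum_crankKernel {k : ℕ} (hk : 1 ≤ k) {q : ℂ} (hq : ‖q‖ < 1) :
    HasSum (fun m : ℤ => (crankWeight k m : ℂ) * (q ^ m.natAbs * crankTheta q m.natAbs))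
      ((∑' x : ℕ × ℕ, (crankWeight k ((x.2 : ℤ) - x.1) : ℂ) * crankKernel q x) *
        ∏' i : ℕ, (1 - q ^ (i + 1))) := by
  have hs : Summable fun x : ℕ × ℕ =>
      (crankWeight k ((x.2 : ℤ) - x.1) : ℂ) * crankKernel q x :=
    Summable.of_norm ((summable_crankKernel hk hq (z := q) rfl).congr fun x => (norm_mul _ _).symm)
  have h1 : HasSum (fun m : ℤ => (crankWeight k m : ℂ) *
      ((1 - q) * q ^ m.natAbs * durfeeSum q m.natAbs (m.natAbs + 2))) _ :=
    (diffMinEquiv.hasSum_iff.mpr hs.hasSum).prod_fiberwise fun m =>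
      (((summable_durfeeTerm hq m.natAbs (m.natAbs + 2)).hasSum.mul_left
        ((1 - q) * q ^ m.natAbs)).mul_left (crankWeight k m : ℂ)).congr_fun fun c => by
          simp only [Function.comp]
          rw [crankKernel_diffMinEquiv]
          congr 3
          simp only [diffMinEquiv, Equiv.coe_fn_mk]
          omega
  refine (h1.mul_right (∏' i : ℕ, (1 - q ^ (i + 1)))).congr_fun fun m => ?_
  rw [← one_sub_mul_durfeeSum_mul hq]
  ring

/-- The value of `(q)_∞` times the generating function of the moments. -/
lemma hasSum_crankTheta {k : ℕ} (hk : 1 ≤ k) {q : ℂ} (hq : ‖q‖ < 1) :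
    HasSum (fun n : ℕ => (-1) ^ n * q ^ (n * (n + 1) / 2 + k * (n + 1)) *
      ((1 + q ^ (n + 1)) / (1 - q ^ (n + 1)) ^ (2 * k)))
      ((∑' x : ℕ × ℕ, (crankWeight k ((x.2 : ℤ) - x.1) : ℂ) * crankKernel q x) *
        ∏' i : ℕ, (1 - q ^ (i + 1))) := by
  let G : ℤ × ℕ → ℂ := fun y => (crankWeight k y.1 : ℂ) * (q ^ y.1.natAbs *
    ((-1) ^ y.2 * q ^ (y.2 * (y.2 + 1) / 2 + y.2 * y.1.natAbs) * (1 - q ^ (y.2 + 1))))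
  have hw : Summable fun m : ℤ => ‖(crankWeight k m : ℂ) * q ^ m.natAbs‖ :=
    (hasSum_crankWeight hk hq).summable.norm
  have hG : Summable G := by
    refine Summable.of_norm_bounded ((hw.mul_of_nonneg (summable_geometric_of_lt_one
      (norm_nonneg q) hq) (fun _ => norm_nonneg _) fun _ => by positivity).mul_right 2) fun y => ?_
    simp only [G]
    rw [← mul_assoc, norm_mul, norm_mul (_ * _ : ℂ) (1 - _), ← mul_assoc]
    refine mul_le_mul (mul_le_mul_of_nonneg_left (norm_thetaTerm_le hq _ _) (norm_nonneg _)) ?_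
      (norm_nonneg _) (by positivity)
    refine (norm_sub_le _ _).trans ?_
    have := norm_pow_lt_one hq y.2.succ_ne_zero
    rw [norm_one]
    linarith
  have h1 : HasSum G _ := hG.hasSum
  have hrow : ∀ m : ℤ, HasSum (fun n => G (m, n))
      ((crankWeight k m : ℂ) * (q ^ m.natAbs * crankTheta q m.natAbs)) := by
    intro m
    exact ((hasSum_crankThetaTerm hq m.natAbs).mul_left (q ^ m.natAbs)).mul_left _
  have h2 := h1.prod_fiberwise hrow
  -- Rows of `G` give the crank side; the columns, summed next, give the Lambert side.
  rw [(hasSum_crankKernel hk hq).unique h2]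
  refine ((Equiv.prodComm ℕ ℤ).hasSum_iff.mpr h1).prod_fiberwise fun n => ?_
  have hne := one_sub_pow_ne_zero hq n.succ_ne_zero
  have h3 := (hasSum_crankWeight hk (norm_pow_lt_one hq n.succ_ne_zero)).mul_left
    ((-1) ^ n * q ^ (n * (n + 1) / 2) * (1 - q ^ (n + 1)))
  have e : (-1) ^ n * q ^ (n * (n + 1) / 2 + k * (n + 1)) *
      ((1 + q ^ (n + 1)) / (1 - q ^ (n + 1)) ^ (2 * k)) =
      (-1) ^ n * q ^ (n * (n + 1) / 2) * (1 - q ^ (n + 1)) *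
        ((q ^ (n + 1)) ^ k * (1 + q ^ (n + 1)) / (1 - q ^ (n + 1)) ^ (2 * k + 1)) := by
    rw [← pow_mul, mul_comm (n + 1) k, pow_add, pow_succ (1 - q ^ (n + 1))]
    field_simp
  rw [e]
  refine h3.congr_fun fun m => ?_
  simp only [G, Function.comp, Equiv.prodComm_apply, Prod.swap, Nat.succ_eq_add_one]
  ring

lemma hasSum_symCrankMoment {k : ℕ} (hk : 1 ≤ k) {q : ℂ} (hq : ‖q‖ < 1) :
    HasSum (fun n : ℕ+ => (symCrankMoment (2 * k) (n : ℕ) : ℂ) * q ^ (n : ℕ))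
      (∑' x : ℕ × ℕ, (crankWeight k ((x.2 : ℤ) - x.1) : ℂ) * crankKernel q x) := by
  have hs : Summable fun x : ℕ × ℕ =>
      ‖(crankWeight k ((x.2 : ℤ) - x.1) : ℂ)‖ * crankKernel ‖q‖ x := by
    refine Summable.of_norm ((summable_crankKernel hk hq (z := ‖q‖) (norm_norm q)).congr
      fun x => ?_)
    rw [norm_mul, norm_norm]
  have h := hasSum_partition hq (w := fun m => (crankWeight k m : ℂ))
    (by simp [crankWeight_zero hk]) (by simp [crankWeight_one hk]) hs
  rw [hasSum_pnat_iff (f := fun n : ℕ => (symCrankMoment (2 * k) n : ℂ) * q ^ n)]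
  have h0 : symCrankMoment (2 * k) 0 = 0 := by
    simp [symCrankMoment_two_mul hk, crank, crankWeight_zero hk]
  rw [h0, Int.cast_zero, zero_mul, add_zero]
  refine h.congr_fun fun n => ?_
  rw [symCrankMoment_two_mul hk, Int.cast_sum]

lemma summable_lambertTerm (k : ℕ) {q : ℂ} (hq : ‖q‖ < 1) :
    Summable fun n : ℕ => (-1) ^ n * q ^ (n * (n + 1) / 2 + k * (n + 1)) /
      (1 - q ^ (n + 1)) ^ (2 * k) := by
  refine Summable.of_norm_bounded ((summable_geometric_of_lt_one (norm_nonneg q) hq).mul_right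
    (((1 - ‖q‖) ^ (2 * k))⁻¹)) fun n => ?_
  rw [norm_div, div_eq_mul_inv, norm_pow (1 - _)]
  have h1 : 0 < 1 - ‖q‖ := sub_pos.mpr hq
  refine mul_le_mul ?_ ?_ (by positivity) (by positivity)
  · rw [norm_mul, norm_pow, norm_neg, norm_one, one_pow, one_mul]
    exact norm_pow_le_norm_pow hq ((le_mul_succ_div_two n).trans (Nat.le_add_right _ _))
  · gcongr
    exact one_sub_norm_le (norm_pow_succ_le hq n)

/-- The two-sided series, obtained by pairing the terms at `n + 1` and `-(n + 1)`. -/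
lemma hasSum_int_lambert {k : ℕ} (hk : 1 ≤ k) {q : ℂ} (hq : ‖q‖ < 1) (hq0 : q ≠ 0) {S : ℂ}
    (hS : HasSum (fun n : ℕ => (-1) ^ n * q ^ (n * (n + 1) / 2 + k * (n + 1)) *
      ((1 + q ^ (n + 1)) / (1 - q ^ (n + 1)) ^ (2 * k))) S) :
    HasSum (fun n : {n : ℤ // n ≠ 0} =>
      (-1 : ℂ) ^ ((n : ℤ) - 1) * q ^ ((n : ℤ) * ((n : ℤ) + 1) / 2 + (k : ℤ) * (n : ℤ)) /
        (1 - q ^ (n : ℤ)) ^ (2 * k)) S := by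
  let G : ℤ → ℂ := fun n => (-1 : ℂ) ^ (n - 1) * q ^ (n * (n + 1) / 2 + (k : ℤ) * n) /
    (1 - q ^ n) ^ (2 * k)
  let A : ℕ → ℂ := fun n => (-1) ^ n * q ^ (n * (n + 1) / 2 + k * (n + 1)) /
    (1 - q ^ (n + 1)) ^ (2 * k)
  have hA : Summable A := summable_lambertTerm k hq
  have hdiv : ∀ n : ℕ, ((n : ℤ) * (n + 1)) / 2 = ((n * (n + 1) / 2 : ℕ) : ℤ) := fun n => by
    push_cast
    rfl
  -- Division by zero makes the excluded term vanish, so the sum over nonzero integers extends to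
  -- all of `ℤ`.
  have hG0 : G 0 = 0 := by
    simp [G, show k ≠ 0 by omega]
  have hpos : ∀ n : ℕ, G ((n + 1 : ℕ) : ℤ) = A n * q ^ (n + 1) := by
    intro n
    simp only [G, A]
    have e : ((n + 1 : ℕ) : ℤ) * (((n + 1 : ℕ) : ℤ) + 1) / 2 + (k : ℤ) * ((n + 1 : ℕ) : ℤ) =
        ((n * (n + 1) / 2 + k * (n + 1) + (n + 1) : ℕ) : ℤ) := by
      rw [hdiv (n + 1), succ_mul_add_two_div_two]
      push_cast
      ring
    rw [e, zpow_natCast, zpow_natCast, show ((n + 1 : ℕ) : ℤ) - 1 = (n : ℤ) by push_cast; ring,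
      zpow_natCast, pow_add q _ (n + 1)]
    ring
  have hneg : ∀ n : ℕ, G (-((n : ℤ) + 1)) = A n := by
    intro n
    have hne := one_sub_pow_ne_zero hq n.succ_ne_zero
    have hqn : q ^ (n + 1) ≠ 0 := pow_ne_zero _ hq0
    simp only [G, A]
    have e1 : -((n : ℤ) + 1) * (-((n : ℤ) + 1) + 1) / 2 + (k : ℤ) * -((n : ℤ) + 1) =
        ((n * (n + 1) / 2 + k * (n + 1) : ℕ) : ℤ) - ((2 * k * (n + 1) : ℕ) : ℤ) := by
      rw [show -((n : ℤ) + 1) * (-((n : ℤ) + 1) + 1) = n * (n + 1) by ring, hdiv n]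
      push_cast
      ring
    have e2 : (-1 : ℂ) ^ (-((n : ℤ) + 1) - 1) = (-1) ^ n := by
      rw [show -((n : ℤ) + 1) - 1 = -((n + 2 : ℕ) : ℤ) by push_cast; ring, zpow_neg, zpow_natCast,
        ← inv_pow, inv_neg, inv_one, pow_add]
      norm_num
    have e3 : q ^ (-((n : ℤ) + 1)) = (q ^ (n + 1))⁻¹ := by
      rw [zpow_neg, ← Nat.cast_succ, zpow_natCast]
    -- The even power absorbs the sign, and the extracted `q^(2k(n + 1))` turns the exponent `-k(n +
    -- 1)` into `k(n + 1)`.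
    have e4 : (1 - (q ^ (n + 1))⁻¹) ^ (2 * k) =
        (1 - q ^ (n + 1)) ^ (2 * k) / q ^ (2 * k * (n + 1)) := by
      rw [mul_comm (2 * k) (n + 1), pow_mul q, ← div_pow,
        ← (even_two_mul k).neg_pow (1 - (q ^ (n + 1))⁻¹)]
      congr 1
      field_simp
      ring
    rw [e1, e2, e3, e4, zpow_sub₀ hq0, zpow_natCast, zpow_natCast]
    have : q ^ (2 * k * (n + 1)) ≠ 0 := pow_ne_zero _ hq0
    field_simp
  have hB : Summable fun n => A n * q ^ (n + 1) := by
    refine Summable.of_norm_bounded hA.norm fun n => ?_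
    rw [norm_mul]
    exact mul_le_of_le_one_right (norm_nonneg _) (norm_pow_lt_one hq n.succ_ne_zero).le
  have h1 : HasSum (fun n : ℕ => G n) (∑' n, A n * q ^ (n + 1)) :=
    hasSum_of_hasSum_nat_add 1 (fun n hn => by rw [Nat.lt_one_iff.mp hn]; exact hG0)
      (hB.hasSum.congr_fun hpos)
  have h2 : HasSum (fun n : ℕ => G (-((n : ℤ) + 1))) (∑' n, A n) := hA.hasSum.congr_fun hneg
  have h3 := h1.of_nat_of_neg_add_one h2
  have h4 : S = ∑' n, A n * q ^ (n + 1) + ∑' n, A n := by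
    refine hS.unique ((hB.hasSum.add hA.hasSum).congr_fun fun n => ?_)
    simp only [A]
    ring
  rw [h4]
  exact (hasSum_subtype_iff_of_support_subset (s := {n : ℤ | n ≠ 0})
    fun n hn h0 => hn (h0 ▸ hG0)).mpr h3

end Summation

theorem mainTheorem6 (k : ℕ) (hk : 1 ≤ k) (q : ℂ) (hq : ‖q‖ < 1) :
    (Multipliable (fun n : ℕ+ => 1 - q ^ (n : ℕ)) ∧ eulerProd q ≠ 0) ∧
    (Summable (fun n : ℕ+ => (symCrankMoment (2 * k) (n : ℕ) : ℂ) * q ^ (n : ℕ)) ∧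
      Summable (fun n : ℕ+ =>
        (-1 : ℂ) ^ ((n : ℕ) - 1) * q ^ ((n : ℕ) * ((n : ℕ) - 1) / 2 + k * (n : ℕ)) *
          ((1 + q ^ (n : ℕ)) / (1 - q ^ (n : ℕ)) ^ (2 * k))) ∧
      ∑' n : ℕ+, (symCrankMoment (2 * k) (n : ℕ) : ℂ) * q ^ (n : ℕ) =
        1 / eulerProd q * ∑' n : ℕ+,
          (-1 : ℂ) ^ ((n : ℕ) - 1) * q ^ ((n : ℕ) * ((n : ℕ) - 1) / 2 + k * (n : ℕ)) *
            ((1 + q ^ (n : ℕ)) / (1 - q ^ (n : ℕ)) ^ (2 * k))) ∧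
    (q ≠ 0 →
      Summable (fun n : {n : ℤ // n ≠ 0} =>
        (-1 : ℂ) ^ ((n : ℤ) - 1) * q ^ ((n : ℤ) * ((n : ℤ) + 1) / 2 + (k : ℤ) * (n : ℤ)) /
          (1 - q ^ (n : ℤ)) ^ (2 * k)) ∧
      ∑' n : ℕ+, (symCrankMoment (2 * k) (n : ℕ) : ℂ) * q ^ (n : ℕ) =
        1 / eulerProd q * ∑' n : {n : ℤ // n ≠ 0},
          (-1 : ℂ) ^ ((n : ℤ) - 1) * q ^ ((n : ℤ) * ((n : ℤ) + 1) / 2 + (k : ℤ) * (n : ℤ)) /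
            (1 - q ^ (n : ℤ)) ^ (2 * k)) := by
  have hprod : eulerProd q = ∏' i : ℕ, (1 - q ^ (i + 1)) :=
    tprod_pnat_eq_tprod_succ (f := fun n => 1 - q ^ n)
  have hne : eulerProd q ≠ 0 := hprod ▸ tprod_one_sub_pow_succ_ne_zero hq
  have hM := hasSum_symCrankMoment hk hq
  have hT := hasSum_crankTheta hk hq
  rw [← hprod, ← hM.tsum_eq] at hT
  have hN : HasSum (fun n : ℕ+ =>
      (-1 : ℂ) ^ ((n : ℕ) - 1) * q ^ ((n : ℕ) * ((n : ℕ) - 1) / 2 + k * (n : ℕ)) *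
        ((1 + q ^ (n : ℕ)) / (1 - q ^ (n : ℕ)) ^ (2 * k))) _ :=
    (hasSum_pnat_iff_hasSum_succ (f := fun n : ℕ =>
      (-1 : ℂ) ^ (n - 1) * q ^ (n * (n - 1) / 2 + k * n) *
        ((1 + q ^ n) / (1 - q ^ n) ^ (2 * k)))).mpr
      (hT.congr_fun fun n => by rw [Nat.add_sub_cancel, mul_comm (n + 1) n])
  refine ⟨⟨multipliable_pnat_iff_multipliable_succ (f := fun n => 1 - q ^ n) |>.mpr
    (multipliable_one_sub_pow_succ hq), hne⟩, ⟨hM.summable, hN.summable, ?_⟩, fun hq0 => ?_⟩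
  · rw [hN.tsum_eq]
    field_simp
  · have hZ := hasSum_int_lambert hk hq hq0 hT
    refine ⟨hZ.summable, ?_⟩
    rw [hZ.tsum_eq]
    field_simp
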